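/- Let $\phi\in\Psi_n$ be a characteristic generator, i.e. $\phi:[0,\infty)\to\mathbb R$ and $\mathbf t\mapsto\phi(\mathbf t'\mathbf t)$ is the characteristic function of a probability distribution on $\mathbb R^n$ (so $\phi(0)=1$), and assume that $\phi$ is not identically $1$. Write $\mathbf X\sim E_n(\boldsymbol\mu,\boldsymbol\Sigma,\phi)$, with $\boldsymbol\mu\in\mathbb R^n$ and $\boldsymbol\Sigma$ a symmetric positive semidefinite $n\times n$ matrix, if the random vector $\mathbf X$ has characteristic function $\mathbf t\mapsto e^{i\mathbf t'\boldsymbol\mu}\phi(\mathbf t'\boldsymbol\Sigma\mathbf t)$. Let $\mathbf X\sim E_n(\boldsymbol\mu^x,\boldsymbol\Sigma^x,\phi)$ and $\mathbf Y\sim E_n(\boldsymbol\mu^y,\boldsymbol\Sigma^y,\phi)$ be random vectors in $\mathbb R^n$ with finite expectations, $E\|\mathbf X\|<\infty$ and $E\|\mathbf Y\|<\infty$. Then the following statements are equivalent: (1) $\boldsymbol\mu^y=\boldsymbol\mu^x$ and $\boldsymbol\Sigma^y-\boldsymbol\Sigma^x$ is positive semidefinite; (2) $\mathbf X\le_{cx}\mathbf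 Y$, i.e. $E[f(\mathbf X)]\le E[f(\mathbf Y)]$ for every convex $f:\mathbb R^n\to\mathbb R$ for which both $f(\mathbf X)$ and $f(\mathbf Y)$ are integrable; (3) $\mathbf X\le_{lcx}\mathbf Y$ (linear convex order), i.e. $E[f(\mathbf a'\mathbf X)]\le E[f(\mathbf a'\mathbf Y)]$ for every $\mathbf a\in\mathbb R^n$ and every convex $f:\mathbb R\to\mathbb R$ for which both $f(\mathbf a'\mathbf X)$ and $f(\mathbf a'\mathbf Y)$ are integrable. -/

import Mathlib

open MeasureTheory
open scoped Matrix

/-- The class `Ψₙ` of characteristic generators: `φ ∈ Ψₙ` iff `t ↦ φ(t't)` is the characteristic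
function of a probability law on `ℝⁿ`. In particular `φ 0 = 1`. Only the values of `φ` on `[0, ∞)`
matter. -/
def IsCharGenerator (n : ℕ) (φ : ℝ → ℝ) : Prop :=
  ∃ ν : Measure (EuclideanSpace ℝ (Fin n)), IsProbabilityMeasure ν ∧
    ∀ t : EuclideanSpace ℝ (Fin n), charFun ν t = ((φ (‖t‖ ^ 2) : ℝ) : ℂ)

/-- `X ∼ Eₙ(m, S, φ)`: the random vector `X` (on the probability space `(Ω, P)`) is elliptically
distributed with location vector `m`, positive semidefinite dispersion matrix `S` and
characteristic generator `φ`, i.e. its characteristic function is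
`t ↦ exp(i t'm) φ(t'St)`. -/
structure IsElliptical {Ω : Type*} [MeasurableSpace Ω] {n : ℕ} (P : Measure Ω)
    (X : Ω → EuclideanSpace ℝ (Fin n)) (m : EuclideanSpace ℝ (Fin n))
    (S : Matrix (Fin n) (Fin n) ℝ) (φ : ℝ → ℝ) : Prop where
  measurable : Measurable X
  generator : IsCharGenerator n φ
  posSemidef : S.PosSemidef
  charFun_eq : ∀ t : EuclideanSpace ℝ (Fin n),
    charFun (P.map X) t =
      Complex.exp (Complex.I * ((inner ℝ t m : ℝ) : ℂ)) * ((φ (t.ofLp ⬝ᵥ (S *ᵥ t.ofLp)) : ℝ) : ℂ)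

/-- Convex order `X ≤_cx Y`: `E f(X) ≤ E f(Y)` for all convex `f : ℝⁿ → ℝ` for which both
expectations exist. -/
def ConvexOrder {Ω Ω' : Type*} [MeasurableSpace Ω] [MeasurableSpace Ω'] {n : ℕ}
    (P : Measure Ω) (Q : Measure Ω')
    (X : Ω → EuclideanSpace ℝ (Fin n)) (Y : Ω' → EuclideanSpace ℝ (Fin n)) : Prop :=
  ∀ f : EuclideanSpace ℝ (Fin n) → ℝ, ConvexOn ℝ Set.univ f →
    Integrable (fun ω => f (X ω)) P → Integrable (fun ω => f (Y ω)) Q →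
      ∫ ω, f (X ω) ∂P ≤ ∫ ω, f (Y ω) ∂Q

/-- Linear convex order `X ≤_lcx Y`: `E f(a'X) ≤ E f(a'Y)` for all `a ∈ ℝⁿ` and all convex
`f : ℝ → ℝ` for which both expectations exist. -/
def LinearConvexOrder {Ω Ω' : Type*} [MeasurableSpace Ω] [MeasurableSpace Ω'] {n : ℕ}
    (P : Measure Ω) (Q : Measure Ω')
    (X : Ω → EuclideanSpace ℝ (Fin n)) (Y : Ω' → EuclideanSpace ℝ (Fin n)) : Prop :=
  ∀ (a : EuclideanSpace ℝ (Fin n)) (f : ℝ → ℝ), ConvexOn ℝ Set.univ f →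
    Integrable (fun ω => f (inner ℝ a (X ω))) P → Integrable (fun ω => f (inner ℝ a (Y ω))) Q →
      ∫ ω, f (inner ℝ a (X ω)) ∂P ≤ ∫ ω, f (inner ℝ a (Y ω)) ∂Q

/-! For (1) ⇒ (2), let `V` be spherical with generator `φ`; then `m + A V` has the law of any
elliptical vector with location `m` and dispersion `A Aᵀ` (`IsElliptical.map_eq`). If `Sx ≤ Sy`, one
matrix `B` gives `Sy = B Bᵀ` and `Sx = (B C)(B C)ᵀ` with `C` diagonal, entries in `[0, 1]`. Now `C`
is a convex combination of diagonal sign matrices `Zₖ`, and every `m + B Zₖ V` has the law of `Y`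
because `Zₖ² = 1`. Convexity of `f`, applied pointwise in `V` and integrated, gives `E f(X) ≤ E
f(Y)`.

For (3) ⇒ (1), the test functions `x` in directions `a` and `-a` equate the means. Then `|x - a'm|`
compares `‖Aᵀa‖` with `‖Bᵀa‖`, both scaled by the same first absolute moment, which is nonzero as
`φ` is not identically 1. Squaring compares the quadratic forms, so no second moments are needed. -/

/-! ### Matrix factorizations and sign vectors -/

/-- Spectral decomposition of a real positive semidefinite matrix. -/
lemma Matrix.PosSemidef.exists_eq_mul_diagonal_mul_transpose {n : ℕ}
    {S : Matrix (Fin n) (Fin n) ℝ} (hS : S.PosSemidef) :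
    ∃ (O : Matrix (Fin n) (Fin n) ℝ) (d : Fin n → ℝ), Oᵀ * O = 1 ∧ O * Oᵀ = 1 ∧ (∀ i, 0 ≤ d i) ∧
      S = O * Matrix.diagonal d * Oᵀ := by
  refine ⟨hS.isHermitian.eigenvectorUnitary, hS.isHermitian.eigenvalues, ?_, ?_,
    fun i => hS.eigenvalues_nonneg i, ?_⟩
  · have := (Matrix.mem_unitaryGroup_iff' (A := (hS.isHermitian.eigenvectorUnitary :
      Matrix (Fin n) (Fin n) ℝ))).1 hS.isHermitian.eigenvectorUnitary.2
    rwa [Matrix.star_eq_conjTranspose, Matrix.conjTranspose_eq_transpose_of_trivial] at this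
  · have := (Matrix.mem_unitaryGroup_iff (A := (hS.isHermitian.eigenvectorUnitary :
      Matrix (Fin n) (Fin n) ℝ))).1 hS.isHermitian.eigenvectorUnitary.2
    rwa [Matrix.star_eq_conjTranspose, Matrix.conjTranspose_eq_transpose_of_trivial] at this
  · have := hS.isHermitian.spectral_theorem
    rwa [Unitary.conjStarAlgAut_apply, Matrix.star_eq_conjTranspose,
      Matrix.conjTranspose_eq_transpose_of_trivial] at this

/-- A positive semidefinite matrix `T` dominated by a diagonal matrix `D` has the form `L M L`,
with `L` the square root of `D` and `0 ≤ M ≤ 1`. -/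
lemma Matrix.PosSemidef.exists_contraction_of_le_diagonal {n : ℕ} {T : Matrix (Fin n) (Fin n) ℝ}
    {d : Fin n → ℝ} (hT : T.PosSemidef) (hd : ∀ i, 0 ≤ d i)
    (hle : (Matrix.diagonal d - T).PosSemidef) :
    ∃ M : Matrix (Fin n) (Fin n) ℝ, M.PosSemidef ∧ (1 - M).PosSemidef ∧
      T = Matrix.diagonal (fun i => √(d i)) * M * Matrix.diagonal (fun i => √(d i)) := by
  -- `N` is a pseudo-inverse of the square root: where `d i = 0`, its entry is `0⁻¹ = 0`.
  set N : Matrix (Fin n) (Fin n) ℝ := Matrix.diagonal (fun i => (√(d i))⁻¹) with hN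
  have hNt : Nᴴ = N := by
    rw [Matrix.conjTranspose_eq_transpose_of_trivial, hN, Matrix.diagonal_transpose]
  refine ⟨N * T * N, ?_, ?_, ?_⟩
  · have := hT.mul_mul_conjTranspose_same N
    rwa [hNt] at this
  -- `1 - N T N` is the sum of `1 - N D N`, a coordinate projection, and `N (D - T) N`.
  · have h1 : (1 - N * Matrix.diagonal d * N).PosSemidef := by
      rw [hN, Matrix.diagonal_mul_diagonal, Matrix.diagonal_mul_diagonal, ← Matrix.diagonal_one,
        Matrix.diagonal_sub, Matrix.posSemidef_diagonal_iff]
      intro i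
      rcases (hd i).eq_or_lt with h | h
      · simp [← h]
      · have h2 : √(d i) ≠ 0 := (Real.sqrt_pos.2 h).ne'
        have h3 : (√(d i))⁻¹ * d i * (√(d i))⁻¹ = 1 := by
          nth_rewrite 2 [← Real.mul_self_sqrt h.le]
          field_simp
        simp [h3]
    have h2 := hle.mul_mul_conjTranspose_same N
    rw [hNt] at h2
    convert h1.add h2 using 1
    noncomm_ring
  -- Where `d i = 0`, domination forces `T i i = 0`, and semidefiniteness then kills the whole row;
  -- so `N` loses nothing.
  · have hzero : ∀ i j, d i = 0 → T i j = 0 := by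
      intro i j hi
      have h1 : T i i = 0 := by
        refine le_antisymm ?_ hT.diag_nonneg
        have := hle.diag_nonneg (i := i)
        simpa [hi] using this
      have h2 : T *ᵥ (Pi.single i 1) = 0 := by
        rw [← hT.dotProduct_mulVec_zero_iff]
        simp [h1]
      have h3 := congrFun h2 j
      have h4 := hT.isHermitian.apply i j
      simp only [star_trivial] at h4
      rw [← h4]
      simpa using h3
    have hsymm : ∀ i j, T i j = T j i := fun i j => by
      simpa using (hT.isHermitian.apply j i)
    ext i j
    rw [hN]
    simp only [Matrix.mul_diagonal, Matrix.diagonal_mul]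
    rcases (hd i).eq_or_lt with h | h
    · simp [hzero i j h.symm]
    rcases (hd j).eq_or_lt with h' | h'
    · simp [hsymm i j, hzero j i h'.symm]
    have h2 : √(d i) ≠ 0 := (Real.sqrt_pos.2 h).ne'
    have h3 : √(d j) ≠ 0 := (Real.sqrt_pos.2 h').ne'
    field_simp

/-- Simultaneous diagonalization by congruence of ordered positive semidefinite matrices. -/
lemma Matrix.PosSemidef.exists_simultaneous_factorization {n : ℕ}
    {T S : Matrix (Fin n) (Fin n) ℝ} (hT : T.PosSemidef) (hS : S.PosSemidef)
    (hle : (S - T).PosSemidef) :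
    ∃ (B : Matrix (Fin n) (Fin n) ℝ) (c : Fin n → ℝ), (∀ i, 0 ≤ c i ∧ c i ≤ 1) ∧ B * Bᵀ = S ∧
      (B * Matrix.diagonal c) * (B * Matrix.diagonal c)ᵀ = T := by
  obtain ⟨O, d, hO, hO', hd, hSd⟩ := hS.exists_eq_mul_diagonal_mul_transpose
  have hD : Oᵀ * S * O = Matrix.diagonal d := by
    calc Oᵀ * S * O = (Oᵀ * O) * Matrix.diagonal d * (Oᵀ * O) := by
          rw [hSd]; simp only [Matrix.mul_assoc]
      _ = Matrix.diagonal d := by rw [hO]; simp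
  have hT' : (Oᵀ * T * O).PosSemidef := by
    simpa using hT.conjTranspose_mul_mul_same O
  have hle' : (Matrix.diagonal d - Oᵀ * T * O).PosSemidef := by
    rw [← hD, ← Matrix.sub_mul, ← Matrix.mul_sub]
    simpa using hle.conjTranspose_mul_mul_same O
  obtain ⟨M, hM, hM1, hTM⟩ := hT'.exists_contraction_of_le_diagonal hd hle'
  obtain ⟨W, e, hW, hW', he, hMe⟩ := hM.exists_eq_mul_diagonal_mul_transpose
  have he1 : ∀ i, e i ≤ 1 := by
    have h1 : (Wᵀ * (1 - M) * W).PosSemidef := by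
      simpa using hM1.conjTranspose_mul_mul_same W
    have h2 : Wᵀ * (1 - M) * W = Matrix.diagonal (fun i => 1 - e i) := by
      calc Wᵀ * (1 - M) * W = Wᵀ * W - (Wᵀ * W) * Matrix.diagonal e * (Wᵀ * W) := by
            rw [hMe]; simp only [Matrix.mul_assoc, Matrix.mul_sub, Matrix.sub_mul, Matrix.one_mul]
        _ = Matrix.diagonal (fun i => 1 - e i) := by
            rw [hW, Matrix.one_mul, Matrix.mul_one, ← Matrix.diagonal_one, Matrix.diagonal_sub]
    rw [h2, Matrix.posSemidef_diagonal_iff] at h1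
    intro i
    linarith [h1 i]
  set L : Matrix (Fin n) (Fin n) ℝ := Matrix.diagonal (fun i => √(d i)) with hL
  have hLL : L * L = Matrix.diagonal d := by
    rw [hL, Matrix.diagonal_mul_diagonal]
    congr 1; ext i; exact Real.mul_self_sqrt (hd i)
  have hLt : Lᵀ = L := Matrix.diagonal_transpose _
  refine ⟨O * L * W, fun i => √(e i),
    fun i => ⟨Real.sqrt_nonneg _, Real.sqrt_le_one.2 (he1 i)⟩, ?_, ?_⟩
  · calc O * L * W * (O * L * W)ᵀ = O * L * (W * Wᵀ) * L * Oᵀ := by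
          simp only [Matrix.transpose_mul, hLt, Matrix.mul_assoc]
      _ = O * (L * L) * Oᵀ := by rw [hW', Matrix.mul_one]; simp only [Matrix.mul_assoc]
      _ = S := by rw [hLL, hSd]
  · have hEE : Matrix.diagonal (fun i => √(e i)) * Matrix.diagonal (fun i => √(e i)) =
        Matrix.diagonal e := by
      rw [Matrix.diagonal_mul_diagonal]
      congr 1; ext i; exact Real.mul_self_sqrt (he i)
    calc _ = O * (L * (W * (Matrix.diagonal (fun i => √(e i)) *
          Matrix.diagonal (fun i => √(e i))) * Wᵀ) * L) * Oᵀ := by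
          simp only [Matrix.transpose_mul, hLt, Matrix.mul_assoc, Matrix.diagonal_transpose]
      _ = (O * Oᵀ) * T * (O * Oᵀ) := by
          rw [hEE, ← hMe, ← hTM]; simp only [Matrix.mul_assoc]
      _ = T := by rw [hO']; simp

lemma Matrix.PosSemidef.exists_mul_transpose_eq {n : ℕ} {S : Matrix (Fin n) (Fin n) ℝ}
    (hS : S.PosSemidef) : ∃ B : Matrix (Fin n) (Fin n) ℝ, B * Bᵀ = S := by
  obtain ⟨B, _, _, hB, _⟩ := hS.exists_simultaneous_factorization hS
    (by simp [Matrix.PosSemidef.zero])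
  exact ⟨B, hB⟩

/-- A vector of the cube `[0, 1]ⁿ` is a convex combination of sign vectors. -/
lemma exists_convex_combination_of_signs {n : ℕ} {c : Fin n → ℝ} (hc : ∀ i, 0 ≤ c i ∧ c i ≤ 1) :
    ∃ (ι : Type) (_ : Fintype ι) (w : ι → ℝ) (z : ι → Fin n → ℝ), (∀ k, 0 ≤ w k) ∧
      ∑ k, w k = 1 ∧ (∀ k i, z k i * z k i = 1) ∧ ∑ k, w k • z k = c := by
  have h : c ∈ convexHull ℝ (Set.univ.pi fun _ : Fin n => ({-1, 1} : Set ℝ)) := by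
    refine mem_convexHull_pi fun i _ => ?_
    rw [convexHull_pair, segment_eq_Icc (by norm_num)]
    exact ⟨by linarith [hc i], (hc i).2⟩
  obtain ⟨ι, hι, w, z, hw, hw1, hz, hsum⟩ := mem_convexHull_iff_exists_fintype.1 h
  refine ⟨ι, hι, w, z, hw, hw1, fun k i => ?_, hsum⟩
  rcases hz k i (Set.mem_univ i) with h | h
  · rw [h]; norm_num
  · rw [Set.mem_singleton_iff.1 h]; norm_num

/-! ### Stochastic representation and the mean -/

/-- The affine map `v ↦ m + A v` of Euclidean space. -/
noncomputable def euclideanAffine {n : ℕ} (m : EuclideanSpace ℝ (Fin n))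
    (A : Matrix (Fin n) (Fin n) ℝ) (v : EuclideanSpace ℝ (Fin n)) : EuclideanSpace ℝ (Fin n) :=
  m + WithLp.toLp 2 (A *ᵥ v.ofLp)

lemma continuous_euclideanAffine {n : ℕ} (m : EuclideanSpace ℝ (Fin n))
    (A : Matrix (Fin n) (Fin n) ℝ) : Continuous (euclideanAffine m A) := by
  unfold euclideanAffine
  fun_prop

lemma inner_euclideanAffine {n : ℕ} (m t v : EuclideanSpace ℝ (Fin n))
    (A : Matrix (Fin n) (Fin n) ℝ) :
    inner ℝ t (euclideanAffine m A v) =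
      inner ℝ t m + inner ℝ v (WithLp.toLp 2 (Aᵀ *ᵥ t.ofLp)) := by
  rw [euclideanAffine, inner_add_right]
  congr 1
  rw [EuclideanSpace.inner_eq_star_dotProduct, EuclideanSpace.inner_eq_star_dotProduct]
  simp only [star_trivial]
  rw [Matrix.mulVec_transpose, ← Matrix.dotProduct_mulVec, dotProduct_comm]

lemma norm_sq_transpose_mulVec {n : ℕ} (t : EuclideanSpace ℝ (Fin n))
    (A : Matrix (Fin n) (Fin n) ℝ) :
    ‖(WithLp.toLp 2 (Aᵀ *ᵥ t.ofLp) : EuclideanSpace ℝ (Fin n))‖ ^ 2 =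
      t.ofLp ⬝ᵥ ((A * Aᵀ) *ᵥ t.ofLp) := by
  rw [← real_inner_self_eq_norm_sq, EuclideanSpace.inner_eq_star_dotProduct]
  simp only [star_trivial]
  rw [← Matrix.mulVec_mulVec, Matrix.dotProduct_mulVec t.ofLp, ← Matrix.mulVec_transpose]

/-- Stochastic representation: `X` is distributed as `m + A V`, with `V` spherical and `A Aᵀ` the
dispersion matrix. -/
lemma IsElliptical.map_eq {Ω : Type*} [MeasurableSpace Ω] {n : ℕ} {P : Measure Ω}
    [IsProbabilityMeasure P] {X : Ω → EuclideanSpace ℝ (Fin n)} {m : EuclideanSpace ℝ (Fin n)}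
    {S : Matrix (Fin n) (Fin n) ℝ} {φ : ℝ → ℝ} (hX : IsElliptical P X m S φ)
    {ν : Measure (EuclideanSpace ℝ (Fin n))} [IsProbabilityMeasure ν]
    (hν : ∀ t, charFun ν t = ((φ (‖t‖ ^ 2) : ℝ) : ℂ))
    {A : Matrix (Fin n) (Fin n) ℝ} (hA : A * Aᵀ = S) :
    P.map X = ν.map (euclideanAffine m A) := by
  have := Measure.isProbabilityMeasure_map (μ := P) hX.measurable.aemeasurable
  have := Measure.isProbabilityMeasure_map (μ := ν)
    (continuous_euclideanAffine m A).measurable.aemeasurable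
  refine Measure.ext_of_charFun (funext fun t => ?_)
  rw [hX.charFun_eq, ← hA, ← norm_sq_transpose_mulVec, ← hν, charFun_apply, charFun_apply,
    integral_map (continuous_euclideanAffine m A).measurable.aemeasurable
      (by fun_prop), ← integral_const_mul]
  refine integral_congr_ae (Filter.Eventually.of_forall fun v => ?_)
  simp only
  rw [real_inner_comm t (euclideanAffine m A v), inner_euclideanAffine, ← Complex.exp_add]
  congr 1
  push_cast
  ring

section Representation

variable {Ω : Type*} [MeasurableSpace Ω] {n : ℕ} {P : Measure Ω} [IsProbabilityMeasure P]
  {X : Ω → EuclideanSpace ℝ (Fin n)} {m : EuclideanSpace ℝ (Fin n)}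
  {S : Matrix (Fin n) (Fin n) ℝ} {φ : ℝ → ℝ} {ν : Measure (EuclideanSpace ℝ (Fin n))}
  [IsProbabilityMeasure ν] {A : Matrix (Fin n) (Fin n) ℝ}

lemma IsElliptical.integral_comp (hX : IsElliptical P X m S φ)
    (hν : ∀ t, charFun ν t = ((φ (‖t‖ ^ 2) : ℝ) : ℂ)) (hA : A * Aᵀ = S)
    {f : EuclideanSpace ℝ (Fin n) → ℝ} (hf : Continuous f) :
    ∫ ω, f (X ω) ∂P = ∫ v, f (euclideanAffine m A v) ∂ν := by
  rw [← integral_map hX.measurable.aemeasurable hf.aestronglyMeasurable, hX.map_eq hν hA,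
    integral_map (continuous_euclideanAffine m A).measurable.aemeasurable hf.aestronglyMeasurable]

lemma IsElliptical.integrable_comp (hX : IsElliptical P X m S φ)
    (hν : ∀ t, charFun ν t = ((φ (‖t‖ ^ 2) : ℝ) : ℂ)) (hA : A * Aᵀ = S)
    {f : EuclideanSpace ℝ (Fin n) → ℝ} (hf : Continuous f) :
    Integrable (fun ω => f (X ω)) P ↔ Integrable (fun v => f (euclideanAffine m A v)) ν := by
  have h1 := integrable_map_measure (μ := P) (f := X) (g := f) hf.aestronglyMeasurable
    hX.measurable.aemeasurable
  have h2 := integrable_map_measure (μ := ν) (f := euclideanAffine m A) (g := f)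
    hf.aestronglyMeasurable (continuous_euclideanAffine m A).measurable.aemeasurable
  rw [hX.map_eq hν hA, h2] at h1
  exact h1.symm

/-- The location vector of an integrable elliptical vector is its mean. -/
lemma IsElliptical.integral_inner (hX : IsElliptical P X m S φ) (hint : Integrable X P)
    (a : EuclideanSpace ℝ (Fin n)) : ∫ ω, inner ℝ a (X ω) ∂P = inner ℝ a m := by
  obtain ⟨ν, _, hν⟩ := hX.generator
  obtain ⟨A, hA⟩ := hX.posSemidef.exists_mul_transpose_eq
  -- `A` and `-A` represent the same law; averaging the two cancels the linear term.
  have hA' : (-A) * (-A)ᵀ = S := by simpa using hA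
  have hcont : Continuous fun x : EuclideanSpace ℝ (Fin n) => (inner ℝ a x : ℝ) := by fun_prop
  have hi : Integrable (fun ω => (inner ℝ a (X ω) : ℝ)) P := hint.const_inner a
  have h1 := hX.integral_comp hν hA hcont
  have h2 := hX.integral_comp hν hA' hcont
  have i1 := (hX.integrable_comp hν hA hcont).1 hi
  have i2 := (hX.integrable_comp hν hA' hcont).1 hi
  have h3 := integral_add i1 i2
  have h4 : ∀ v, (inner ℝ a (euclideanAffine m A v) : ℝ) + inner ℝ a (euclideanAffine m (-A) v) =
      2 * inner ℝ a m := by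
    intro v
    simp only [euclideanAffine, Matrix.neg_mulVec, WithLp.toLp_neg, inner_add_right,
      inner_neg_right]
    ring
  simp only [h4, integral_const, probReal_univ, one_smul] at h3
  linarith

end Representation

/-! ### Marginals of spherical laws -/

/-- One-dimensional marginals of a spherical law depend on the direction only through its norm. -/
lemma map_inner_eq_of_norm_eq {n : ℕ} {φ : ℝ → ℝ} {ν : Measure (EuclideanSpace ℝ (Fin n))}
    [IsProbabilityMeasure ν] (hν : ∀ t, charFun ν t = ((φ (‖t‖ ^ 2) : ℝ) : ℂ))
    {u w : EuclideanSpace ℝ (Fin n)} (h : ‖u‖ = ‖w‖) :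
    ν.map (fun v => (inner ℝ v u : ℝ)) = ν.map (fun v => (inner ℝ v w : ℝ)) := by
  have hm : ∀ u : EuclideanSpace ℝ (Fin n), AEMeasurable (fun v => (inner ℝ v u : ℝ)) ν :=
    fun u => by fun_prop
  have := Measure.isProbabilityMeasure_map (hm u)
  have := Measure.isProbabilityMeasure_map (hm w)
  have key : ∀ (u : EuclideanSpace ℝ (Fin n)) (s : ℝ),
      charFun (ν.map (fun v => (inner ℝ v u : ℝ))) s = ((φ (‖s • u‖ ^ 2) : ℝ) : ℂ) := by
    intro u s
    rw [← hν, charFun_apply_real, charFun_apply, integral_map (hm u) (by fun_prop)]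
    simp only [inner_smul_right]
    push_cast
    rfl
  refine Measure.ext_of_charFun (funext fun s => ?_)
  rw [key, key, norm_smul, norm_smul, h]

lemma eq_one_of_inner_ae_eq_zero {n : ℕ} {φ : ℝ → ℝ} {ν : Measure (EuclideanSpace ℝ (Fin n))}
    [IsProbabilityMeasure ν] (hν : ∀ t, charFun ν t = ((φ (‖t‖ ^ 2) : ℝ) : ℂ))
    {w : EuclideanSpace ℝ (Fin n)} (hw : w ≠ 0) (h : ∀ᵐ v ∂ν, (inner ℝ v w : ℝ) = 0)
    {r : ℝ} (hr : 0 ≤ r) : φ r = 1 := by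
  have hw' : ‖w‖ ≠ 0 := norm_ne_zero_iff.2 hw
  -- This multiple of `w` has squared norm `r`, and its inner product with `v` still vanishes almost
  -- surely.
  have h1 := hν ((√r / ‖w‖) • w)
  rw [norm_smul, norm_div, norm_norm, div_mul_cancel₀ _ hw', Real.norm_eq_abs, sq_abs,
    Real.sq_sqrt hr, charFun_apply] at h1
  have h2 : ∫ v, Complex.exp (((inner ℝ v ((√r / ‖w‖) • w) : ℝ) : ℂ) * Complex.I) ∂ν =
      ∫ _, (1 : ℂ) ∂ν := by
    refine integral_congr_ae ?_
    filter_upwards [h] with v hv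
    simp [inner_smul_right, hv]
  rw [h2] at h1
  simp only [integral_const, probReal_univ, one_smul] at h1
  exact_mod_cast h1.symm

/-- First absolute moments of the marginals of a nondegenerate spherical law are strictly monotone
in the norm of the direction. -/
lemma norm_le_of_integral_abs_inner_le {n : ℕ} {φ : ℝ → ℝ}
    {ν : Measure (EuclideanSpace ℝ (Fin n))} [IsProbabilityMeasure ν]
    (hν : ∀ t, charFun ν t = ((φ (‖t‖ ^ 2) : ℝ) : ℂ)) (hφ : ∃ r : ℝ, 0 ≤ r ∧ φ r ≠ 1)
    {u w : EuclideanSpace ℝ (Fin n)} (hint : Integrable (fun v => |(inner ℝ v u : ℝ)|) ν)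
    (h : ∫ v, |(inner ℝ v u : ℝ)| ∂ν ≤ ∫ v, |(inner ℝ v w : ℝ)| ∂ν) : ‖u‖ ≤ ‖w‖ := by
  by_contra! hlt
  have hu : 0 < ‖u‖ := (norm_nonneg w).trans_lt hlt
  set k : ℝ := ‖w‖ / ‖u‖ with hk
  have hk0 : 0 ≤ k := by positivity
  have hk1 : k < 1 := (div_lt_one hu).2 hlt
  have hnorm : ‖w‖ = ‖k • u‖ := by
    rw [norm_smul, Real.norm_eq_abs, abs_of_nonneg hk0, hk, div_mul_cancel₀ _ hu.ne']
  have hm : ∀ u : EuclideanSpace ℝ (Fin n), AEMeasurable (fun v => (inner ℝ v u : ℝ)) ν :=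
    fun u => by fun_prop
  have habs : ∀ μ : Measure ℝ, AEStronglyMeasurable (fun x : ℝ => |x|) μ :=
    fun _ => continuous_abs.aestronglyMeasurable
  have h1 : ∫ v, |(inner ℝ v w : ℝ)| ∂ν = k * ∫ v, |(inner ℝ v u : ℝ)| ∂ν := by
    rw [← integral_map (hm w) (habs _), map_inner_eq_of_norm_eq hν hnorm,
      integral_map (hm _) (habs _), ← integral_const_mul]
    simp only [inner_smul_right, abs_mul, abs_of_nonneg hk0]
  have h2 : 0 ≤ ∫ v, |(inner ℝ v u : ℝ)| ∂ν := integral_nonneg fun _ => abs_nonneg _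
  -- The moment is at most `k < 1` times itself.
  have h3 : ∫ v, |(inner ℝ v u : ℝ)| ∂ν = 0 := by nlinarith
  rw [integral_eq_zero_iff_of_nonneg (fun _ => abs_nonneg _) hint] at h3
  obtain ⟨r, hr, hr1⟩ := hφ
  refine hr1 (eq_one_of_inner_ae_eq_zero hν (norm_pos_iff.1 hu) ?_ hr)
  filter_upwards [h3] with v hv
  simpa using hv

/-! ### Comparison of the orders -/

lemma ConvexOn.continuous_of_finiteDimensional {E : Type*} [NormedAddCommGroup E]
    [NormedSpace ℝ E] [FiniteDimensional ℝ E] {f : E → ℝ} (hf : ConvexOn ℝ Set.univ f) :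
    Continuous f :=
  continuousOn_univ.1 (hf.continuousOn isOpen_univ)

lemma ConvexOrder.linearConvexOrder {Ω Ω' : Type*} [MeasurableSpace Ω] [MeasurableSpace Ω']
    {n : ℕ} {P : Measure Ω} {Q : Measure Ω'} {X : Ω → EuclideanSpace ℝ (Fin n)}
    {Y : Ω' → EuclideanSpace ℝ (Fin n)} (h : ConvexOrder P Q X Y) :
    LinearConvexOrder P Q X Y := by
  intro a f hf hfX hfY
  exact h (fun x => f (inner ℝ a x))
    (hf.comp_linearMap (innerSL ℝ a : EuclideanSpace ℝ (Fin n) →L[ℝ] ℝ).toLinearMap) hfX hfY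

section Order

variable {Ω Ω' : Type*} [MeasurableSpace Ω] [MeasurableSpace Ω'] {n : ℕ}
  {P : Measure Ω} {Q : Measure Ω'} [IsProbabilityMeasure P] [IsProbabilityMeasure Q]
  {X : Ω → EuclideanSpace ℝ (Fin n)} {Y : Ω' → EuclideanSpace ℝ (Fin n)}
  {μx μy : EuclideanSpace ℝ (Fin n)} {Sx Sy : Matrix (Fin n) (Fin n) ℝ} {φ : ℝ → ℝ}

lemma IsElliptical.convexOrder {m : EuclideanSpace ℝ (Fin n)} (hX : IsElliptical P X m Sx φ)
    (hY : IsElliptical Q Y m Sy φ) (hS : (Sy - Sx).PosSemidef) : ConvexOrder P Q X Y := by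
  intro f hf hfX hfY
  have hfc := hf.continuous_of_finiteDimensional
  obtain ⟨ν, _, hν⟩ := hX.generator
  obtain ⟨B, c, hc, hB, hBc⟩ :=
    hX.posSemidef.exists_simultaneous_factorization hY.posSemidef hS
  obtain ⟨ι, _, w, z, hw, hw1, hz, hsum⟩ := exists_convex_combination_of_signs hc
  -- Sign changes leave the dispersion `Sy` unchanged, so integrability of `f(Y)` passes to every
  -- term of the combination.
  have hBz : ∀ k, (B * Matrix.diagonal (z k)) * (B * Matrix.diagonal (z k))ᵀ = Sy := by
    intro k
    have h1 : Matrix.diagonal (z k) * Matrix.diagonal (z k) = 1 := by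
      rw [Matrix.diagonal_mul_diagonal, ← Matrix.diagonal_one]
      congr 1; ext i; exact hz k i
    calc _ = B * (Matrix.diagonal (z k) * Matrix.diagonal (z k)) * Bᵀ := by
          simp only [Matrix.transpose_mul, Matrix.diagonal_transpose, Matrix.mul_assoc]
      _ = Sy := by rw [h1, Matrix.mul_one, hB]
  have hik := fun k => (hY.integrable_comp hν (hBz k) hfc).1 hfY
  have hcomb : ∀ v, euclideanAffine m (B * Matrix.diagonal c) v =
      ∑ k, w k • euclideanAffine m (B * Matrix.diagonal (z k)) v := by
    intro v
    simp only [euclideanAffine, smul_add, Finset.sum_add_distrib]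
    rw [← Finset.sum_smul, hw1, one_smul, ← hsum]
    congr 1
    simp only [← WithLp.toLp_smul, ← WithLp.toLp_sum]
    congr 1
    simp only [← Matrix.smul_mulVec, ← Matrix.sum_mulVec, ← Matrix.mul_smul, ← Matrix.mul_sum,
      ← Matrix.diagonal_smul]
    congr 2
    ext i j
    simp only [Matrix.sum_apply, Matrix.diagonal_apply, Finset.sum_apply]
    split_ifs <;> simp
  calc ∫ ω, f (X ω) ∂P = ∫ v, f (euclideanAffine m (B * Matrix.diagonal c) v) ∂ν :=
        hX.integral_comp hν hBc hfc
    _ ≤ ∫ v, ∑ k, w k * f (euclideanAffine m (B * Matrix.diagonal (z k)) v) ∂ν := by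
        refine integral_mono ((hX.integrable_comp hν hBc hfc).1 hfX)
          (integrable_finsetSum _ fun k _ => (hik k).const_mul _) fun v => ?_
        simp only
        rw [hcomb]
        exact hf.map_sum_le (fun k _ => hw k) hw1 fun _ _ => Set.mem_univ _
    _ = ∑ k, w k * ∫ ω, f (Y ω) ∂Q := by
        rw [integral_finsetSum _ fun k _ => (hik k).const_mul _]
        refine Finset.sum_congr rfl fun k _ => ?_
        rw [integral_const_mul, ← hY.integral_comp hν (hBz k) hfc]
    _ = ∫ ω, f (Y ω) ∂Q := by rw [← Finset.sum_mul, hw1, one_mul]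

lemma LinearConvexOrder.location_eq (h : LinearConvexOrder P Q X Y)
    (hX : IsElliptical P X μx Sx φ) (hY : IsElliptical Q Y μy Sy φ)
    (hXint : Integrable X P) (hYint : Integrable Y Q) : μy = μx := by
  refine ext_inner_left ℝ fun a => ?_
  have h1 := h a (fun x => x) (convexOn_id convex_univ) (hXint.const_inner a)
    (hYint.const_inner a)
  have h2 := h (-a) (fun x => x) (convexOn_id convex_univ) (hXint.const_inner (-a))
    (hYint.const_inner (-a))
  rw [hX.integral_inner hXint, hY.integral_inner hYint] at h1 h2
  rw [inner_neg_left, inner_neg_left] at h2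
  linarith

lemma LinearConvexOrder.posSemidef_sub (h : LinearConvexOrder P Q X Y)
    {m : EuclideanSpace ℝ (Fin n)} (hX : IsElliptical P X m Sx φ) (hY : IsElliptical Q Y m Sy φ)
    (hφ : ∃ u : ℝ, 0 ≤ u ∧ φ u ≠ 1) (hXint : Integrable X P) (hYint : Integrable Y Q) :
    (Sy - Sx).PosSemidef := by
  obtain ⟨ν, _, hν⟩ := hX.generator
  obtain ⟨A, hA⟩ := hX.posSemidef.exists_mul_transpose_eq
  obtain ⟨B, hB⟩ := hY.posSemidef.exists_mul_transpose_eq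
  refine Matrix.PosSemidef.of_dotProduct_mulVec_nonneg
    (hY.posSemidef.isHermitian.sub hX.posSemidef.isHermitian) fun t => ?_
  set a : EuclideanSpace ℝ (Fin n) := WithLp.toLp 2 t with ha
  -- Centring at the common mean leaves `|⟨v, Aᵀa⟩|` and `|⟨v, Bᵀa⟩|`.
  set f : ℝ → ℝ := fun x => |x - inner ℝ a m| with hf
  have hfconv : ConvexOn ℝ Set.univ f := by
    have := (convexOn_norm (E := ℝ) convex_univ).translate_left (-(inner ℝ a m : ℝ))
    simpa only [Set.preimage_univ, Function.comp_def, ← sub_eq_add_neg, Real.norm_eq_abs] using this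
  have hfX : Integrable (fun ω => f (inner ℝ a (X ω))) P :=
    ((hXint.const_inner a).sub (integrable_const _)).abs
  have hfY : Integrable (fun ω => f (inner ℝ a (Y ω))) Q :=
    ((hYint.const_inner a).sub (integrable_const _)).abs
  have hcont : Continuous fun x : EuclideanSpace ℝ (Fin n) => f (inner ℝ a x) := by fun_prop
  have h1 := h a f hfconv hfX hfY
  have hi := (hX.integrable_comp hν hA hcont).1 hfX
  rw [hX.integral_comp hν hA hcont, hY.integral_comp hν hB hcont] at h1
  simp only [hf, inner_euclideanAffine, add_sub_cancel_left] at h1 hi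
  have h2 := norm_le_of_integral_abs_inner_le hν hφ hi h1
  have h3 := pow_le_pow_left₀ (norm_nonneg _) h2 2
  rw [norm_sq_transpose_mulVec, norm_sq_transpose_mulVec, hA, hB] at h3
  rw [star_trivial, Matrix.sub_mulVec, dotProduct_sub]
  exact sub_nonneg.2 h3

end Order

theorem theorem3p2 {Ω Ω' : Type*} [MeasurableSpace Ω] [MeasurableSpace Ω'] {n : ℕ}
    (P : Measure Ω) (Q : Measure Ω') [IsProbabilityMeasure P] [IsProbabilityMeasure Q]
    (X : Ω → EuclideanSpace ℝ (Fin n)) (Y : Ω' → EuclideanSpace ℝ (Fin n))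
    (μx μy : EuclideanSpace ℝ (Fin n)) (Sx Sy : Matrix (Fin n) (Fin n) ℝ) (φ : ℝ → ℝ)
    (hX : IsElliptical P X μx Sx φ) (hY : IsElliptical Q Y μy Sy φ)
    (hφ : ∃ u : ℝ, 0 ≤ u ∧ φ u ≠ 1)
    (hXint : Integrable X P) (hYint : Integrable Y Q) :
    List.TFAE [
      μy = μx ∧ (Sy - Sx).PosSemidef,
      ConvexOrder P Q X Y,
      LinearConvexOrder P Q X Y] := by
  tfae_have 1 → 2 := by
    rintro ⟨rfl, hS⟩
    exact hX.convexOrder hY hS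
  tfae_have 2 → 3 := ConvexOrder.linearConvexOrder
  tfae_have 3 → 1 := by
    intro h
    obtain rfl := h.location_eq hX hY hXint hYint
    exact ⟨rfl, h.posSemidef_sub hX hY hφ hXint hYint⟩
  tfae_finish
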